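/- A \emph{circular arc} is a set $\{r e^{it} : \alpha\le t\le\beta\}\subset\mathbb C$ with $r>0$ and $0<\beta-\alpha<2\pi$. Take a family of $n$ pairwise disjoint circular arcs (all centred at the origin; equal radii are allowed). Its \emph{visibility graph} has one vertex for each arc, and two distinct vertices are adjacent if and only if there are a point $p$ of the first arc and a point $q$ of the second such that $p$, $q$ and the origin are collinear and the segment from $p$ to $q$ (which may pass through the origin) meets no other arc of the family. A graph that arises in this way is called an \emph{arc visibility graph}. The maximum number of edges in an arc visibility graph with $n$ vertices is $\binom n2$ if $n\le 5$ and $3n-3$ if $n\ge 6$; that is, no arc visibility graph on $n$ vertices has more edges than this, and for each $n$ some arc visibility graph on $n$ vertices has exactly this many. -/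

import Mathlib

/-- A circular arc centred at the origin of the plane `ℂ`: it has a positive radius and consists of
the points whose argument runs from `α` (the negative endpoint) to `β` (the positive endpoint),
where `0 < β - α < 2π`. -/
structure CircularArc where
  radius : ℝ
  α : ℝ
  β : ℝ
  radius_pos : 0 < radius
  α_lt_β : α < β
  β_lt : β < α + 2 * Real.pi

/-- The closed set of points of an arc (both endpoints are included);
`circleMap 0 r t = r * exp (t * I)`. -/
noncomputable def CircularArc.points (a : CircularArc) : Set ℂ :=
  circleMap 0 a.radius '' Set.Icc a.α a.β

/-- An arc visibility representation with vertex set `V`: one arc for each vertex, all arcs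
concentric and pairwise disjoint. Different arcs may have the same radius. -/
structure ArcRepresentation (V : Type*) where
  arc : V → CircularArc
  disjoint : ∀ u v : V, u ≠ v → Disjoint (arc u).points (arc v).points

namespace ArcRepresentation

variable {V : Type*} (R : ArcRepresentation V)

/-- The arcs, other than those of `u` and `v`, that meet the segment from `p` to `q`.
An arc that meets the segment twice is counted once. -/
def obstacles (u v : V) (p q : ℂ) : Set V :=
  {w | w ≠ u ∧ w ≠ v ∧ (segment ℝ p q ∩ (R.arc w).points).Nonempty}

/-- The segment from `p` to `q` is a line of sight from the arc of `u` to the arc of `v`: it is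
radial (it lies on a line through the centre, and may pass through the centre) and it meets at most
`k` further arcs. -/
def IsLineOfSight (k : ℕ) (u v : V) (p q : ℂ) : Prop :=
  p ∈ (R.arc u).points ∧ q ∈ (R.arc v).points ∧ Collinear ℝ {0, p, q} ∧
    (R.obstacles u v p q).encard ≤ k

/-- The `k`-visibility graph of a representation: two distinct vertices are adjacent if and only if
some line of sight joins their arcs. -/
def visibilityGraph (k : ℕ) : SimpleGraph V where
  Adj u v := u ≠ v ∧ ∃ p q : ℂ, R.IsLineOfSight k u v p q
  symm := by
    constructor
    rintro u v ⟨huv, p, q, hp, hq, hc, hk⟩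
    refine ⟨huv.symm, q, p, hq, hp, ?_, ?_⟩
    · rwa [Set.pair_comm q p]
    · have h : R.obstacles v u q p = R.obstacles u v p q := by
        ext w
        simp only [obstacles, Set.mem_ofPred_eq, segment_symm ℝ q p]
        tauto
      rwa [h]
  loopless := ⟨fun _ h => h.1 rfl⟩

end ArcRepresentation

/-- An arc `k`-visibility graph: the `k`-visibility graph of some arc representation. -/
def IsArcKVisibilityGraph {V : Type*} (k : ℕ) (G : SimpleGraph V) : Prop :=
  ∃ R : ArcRepresentation V, R.visibilityGraph k = G

/-- An arc visibility graph: lines of sight have to be unobstructed. -/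
def IsArcVisibilityGraph {V : Type*} (G : SimpleGraph V) : Prop :=
  IsArcKVisibilityGraph 0 G

/-- The numbers of edges of the arc visibility graphs with `n` vertices. -/
def arcVisibilityEdgeCounts (n : ℕ) : Set ℕ :=
  {m | ∃ G : SimpleGraph (Fin n), IsArcVisibilityGraph G ∧ G.edgeSet.ncard = m}

/-! Upper bound. A line through the centre is turned. The points in which it meets the arcs are
strands `(v, m)`, the index `m` counting half turns; an edge is a pair of strands consecutive on
some line. Turned backwards, such a pair stays consecutive until one of its arcs begins or an arc
ends that separated the two (`Consec.exists_event`). Each arc thus offers three slots: the outer and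
inner sides of its beginning, and its end. A slot determines its pair (`Charge.unique`), so there
are at most `3n` edges.

Three slots are superfluous (`exists_lost_slots`). The arc `u` of largest radius has nothing outside
it, so its outer slot and its end slot are empty. For the third, the top strand is followed across
the angular gap of `u`. If some line is empty, an arc later begins alone and its inner slot is
empty; if the top strand changes, an arc begins or ends on top and again a slot is empty. Otherwise
a single strand is next to `u` at both ends of the gap. The pair in the inner slot of `u` is then
also seen at the end of `u`, and turning back from there charges it to another slot.

This needs distinct radii and endpoints in general position; a small enlargement of the arcs
achieves it without losing an edge (`exists_genericArcs`).

Lower bound. Six explicit arcs see one another pairwise. Around them come ever longer arcs whose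
gaps shrink to one direction; each sees its predecessor and, through the gaps, two fixed arcs. This
gives `15 + 3(n - 6)` edges, and the first `n ≤ 6` arcs give a complete graph. -/

/-! ### Strands on a line through the centre -/

/-- The signed coordinate, on the line of direction `t`, of the point of argument `t + m * π` and
modulus `r`. -/
noncomputable def strandPos {V : Type*} (r : V → ℝ) (s : V × ℤ) : ℝ := (-1) ^ s.2 * r s.1

/-- The strand `(v, m)` meets the line of direction `t`: the arc of `v` contains the argument
`t + m * π`. -/
def StrandPresent {V : Type*} (a b : V → ℝ) (s : V × ℤ) (t : ℝ) : Prop :=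
  a s.1 - s.2 * Real.pi ≤ t ∧ t ≤ b s.1 - s.2 * Real.pi

/-- On the line of direction `t`, no strand of a third arc lies between the strands `s` and `s'`. -/
def StrandSight {V : Type*} (r a b : V → ℝ) (s s' : V × ℤ) (t : ℝ) : Prop :=
  StrandPresent a b s t ∧ StrandPresent a b s' t ∧
    ∀ w : V × ℤ, StrandPresent a b w t → w.1 ≠ s.1 → w.1 ≠ s'.1 →
      strandPos r w ∉ Set.uIcc (strandPos r s) (strandPos r s')

lemma circleMap_add_int_mul_pi (r t : ℝ) (m : ℤ) :
    circleMap 0 r (t + m * Real.pi) = ((-1) ^ m * r : ℝ) • Complex.exp (t * Complex.I) := by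
  have h : Complex.exp ((m : ℂ) * (Real.pi * Complex.I)) = (-1) ^ m := by
    rw [Complex.exp_int_mul, Complex.exp_pi_mul_I]
  simp only [circleMap, zero_add, Complex.real_smul]
  push_cast
  rw [← h, add_mul, Complex.exp_add]
  ring_nf

/-- Division by `exp (t * I)` leaves a real number of argument `τ - t`, so `sin (τ - t) = 0`. -/
lemma exists_eq_add_int_mul_pi {r τ t x : ℝ} (hr : 0 < r)
    (h : circleMap 0 r τ = x • Complex.exp (t * Complex.I)) :
    ∃ m : ℤ, τ = t + m * Real.pi ∧ x = (-1) ^ m * r := by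
  have hsin : Real.sin (τ - t) = 0 := by
    have h1 : (r : ℂ) * Complex.exp ((τ - t : ℝ) * Complex.I) = x := by
      have h2 : circleMap 0 r τ * Complex.exp (-(t * Complex.I)) = x := by
        rw [h, Complex.real_smul, mul_assoc, ← Complex.exp_add]
        simp
      rw [← h2]
      simp only [circleMap, zero_add]
      rw [mul_assoc, ← Complex.exp_add]
      push_cast
      ring_nf
    have h3 := congrArg Complex.im h1
    rw [Complex.im_ofReal_mul, Complex.exp_ofReal_mul_I_im, Complex.ofReal_im] at h3
    exact (mul_eq_zero.1 h3).resolve_left hr.ne'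
  obtain ⟨m, hm⟩ := Real.sin_eq_zero_iff.1 hsin
  have hτ : τ = t + m * Real.pi := by linarith
  refine ⟨m, hτ, ?_⟩
  rw [hτ, circleMap_add_int_mul_pi] at h
  exact (smul_left_injective ℝ (Complex.exp_ne_zero _) h).symm

lemma mem_segment_smul_iff {x y : ℝ} {e z : ℂ} :
    z ∈ segment ℝ (x • e) (y • e) ↔ ∃ c ∈ Set.uIcc x y, z = c • e := by
  have h := image_segment ℝ (LinearMap.toSpanSingleton ℝ ℂ e).toAffineMap x y
  simp only [LinearMap.coe_toAffineMap, LinearMap.toSpanSingleton_apply] at h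
  rw [← h, segment_eq_uIcc]
  simp [Set.mem_image, eq_comm]

namespace ArcRepresentation

variable {V : Type*} (R : ArcRepresentation V)

/-- Adjacency in the visibility graph, in terms of strands on a common line. -/
lemma visibilityGraph_adj_iff (u v : V) :
    (R.visibilityGraph 0).Adj u v ↔ u ≠ v ∧ ∃ (t : ℝ) (k l : ℤ),
      StrandSight (fun w => (R.arc w).radius) (fun w => (R.arc w).α) (fun w => (R.arc w).β)
        (u, k) (v, l) t := by
  have key : ∀ (t : ℝ) (k l : ℤ), R.obstacles u v
      ((strandPos (fun w => (R.arc w).radius) (u, k)) • Complex.exp (t * Complex.I))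
      ((strandPos (fun w => (R.arc w).radius) (v, l)) • Complex.exp (t * Complex.I)) = ∅ ↔
      ∀ w : V × ℤ, StrandPresent (fun w => (R.arc w).α) (fun w => (R.arc w).β) w t →
        w.1 ≠ u → w.1 ≠ v → strandPos (fun w => (R.arc w).radius) w ∉
          Set.uIcc (strandPos (fun w => (R.arc w).radius) (u, k))
            (strandPos (fun w => (R.arc w).radius) (v, l)) := by
    intro t k l
    rw [Set.eq_empty_iff_forall_notMem]
    constructor
    · rintro h ⟨w, m⟩ ⟨h1, h2⟩ hu hv hmem
      refine h w ⟨hu, hv, _, mem_segment_smul_iff.2 ⟨_, hmem, rfl⟩, t + m * Real.pi,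
        ⟨?_, ?_⟩, ?_⟩
      · simp only at h1; linarith
      · simp only at h2; linarith
      · exact circleMap_add_int_mul_pi _ _ _
    · rintro h w ⟨hu, hv, z, hz, τ, ⟨h1, h2⟩, hτ⟩
      obtain ⟨c, hc, rfl⟩ := mem_segment_smul_iff.1 hz
      obtain ⟨m, rfl, rfl⟩ := exists_eq_add_int_mul_pi (R.arc w).radius_pos hτ
      refine h (w, m) ⟨?_, ?_⟩ hu hv hc
      · simp only; linarith
      · simp only; linarith
  constructor
  · rintro ⟨huv, p, q, ⟨t, ht, rfl⟩, ⟨τ, hτ, rfl⟩, hcol, hobs⟩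
    -- The argument of `p` serves as the direction of the line, so the strand of `u` has index `0`.
    refine ⟨huv, t, 0, ?_⟩
    have hp : circleMap 0 (R.arc u).radius t =
        (strandPos (fun w => (R.arc w).radius) (u, 0)) • Complex.exp (t * Complex.I) := by
      have := circleMap_add_int_mul_pi (R.arc u).radius t 0
      simpa [strandPos] using this
    have hq : ∃ x : ℝ, circleMap 0 (R.arc v).radius τ = x • Complex.exp (t * Complex.I) := by
      obtain ⟨d, hd⟩ := (collinear_iff_of_mem (p₀ := (0 : ℂ)) (by simp)).1 hcol
      obtain ⟨c₁, h₁⟩ := hd _ (show circleMap 0 (R.arc u).radius t ∈ _ by simp)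
      obtain ⟨c₂, h₂⟩ := hd _ (show circleMap 0 (R.arc v).radius τ ∈ _ by simp)
      simp only [vadd_eq_add, add_zero] at h₁ h₂
      have hne : circleMap 0 (R.arc u).radius t ≠ 0 :=
        circleMap_ne_center (R.arc u).radius_pos.ne'
      have hc₁ : c₁ ≠ 0 := by
        rintro rfl
        exact hne (by simpa using h₁)
      refine ⟨c₂ * c₁⁻¹ * strandPos (fun w => (R.arc w).radius) (u, 0), ?_⟩
      rw [mul_smul, ← hp, h₁, h₂, smul_smul, mul_assoc, inv_mul_cancel₀ hc₁, mul_one]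
    obtain ⟨x, hx⟩ := hq
    obtain ⟨l, rfl, rfl⟩ := exists_eq_add_int_mul_pi (R.arc v).radius_pos hx
    refine ⟨l, ⟨?_, ?_⟩, ⟨?_, ?_⟩, (key t 0 l).1 ?_⟩
    · simpa using ht.1
    · simpa using ht.2
    · have := hτ.1; simp only; linarith
    · have := hτ.2; simp only; linarith
    · rw [hp, hx] at hobs
      rw [Nat.cast_zero, nonpos_iff_eq_zero] at hobs
      exact Set.encard_eq_zero.1 hobs
  · rintro ⟨huv, t, k, l, ⟨h1, h2⟩, ⟨h3, h4⟩, h⟩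
    simp only at h1 h2 h3 h4
    refine ⟨huv, _, _, ⟨t + k * Real.pi, ⟨?_, ?_⟩, circleMap_add_int_mul_pi _ _ _⟩,
      ⟨t + l * Real.pi, ⟨?_, ?_⟩, circleMap_add_int_mul_pi _ _ _⟩, ?_, ?_⟩
    any_goals linarith
    · rw [collinear_iff_of_mem (p₀ := (0 : ℂ)) (by simp)]
      refine ⟨Complex.exp (t * Complex.I), ?_⟩
      rintro p (rfl | rfl | rfl)
      · exact ⟨0, by simp⟩
      · exact ⟨_, by rw [vadd_eq_add, add_zero]⟩
      · exact ⟨_, by rw [vadd_eq_add, add_zero]⟩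
    · have := (key t k l).2 h
      simp only [strandPos] at this
      rw [this]
      simp

end ArcRepresentation

/-! ### Arcs in general position -/

/-- Arcs in general position: distinct radii, and no two endpoints on a common line through the
centre. -/
structure GenericArcs (V : Type*) where
  r : V → ℝ
  a : V → ℝ
  b : V → ℝ
  r_pos : ∀ v, 0 < r v
  r_inj : Function.Injective r
  a_lt_b : ∀ v, a v < b v
  b_lt : ∀ v, b v < a v + 2 * Real.pi
  a_inj : ∀ v w (m : ℤ), a v + m * Real.pi = a w → v = w
  b_inj : ∀ v w (m : ℤ), b v + m * Real.pi = b w → v = w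
  a_ne_b : ∀ v w (m : ℤ), a v + m * Real.pi ≠ b w

namespace GenericArcs

variable {V : Type*} (A : GenericArcs V)

/-- The direction at which a strand appears. -/
noncomputable def birth (s : V × ℤ) : ℝ := A.a s.1 - s.2 * Real.pi

/-- The direction at which a strand disappears. -/
noncomputable def death (s : V × ℤ) : ℝ := A.b s.1 - s.2 * Real.pi

/-- The signed coordinate of a strand. -/
noncomputable def pos (s : V × ℤ) : ℝ := strandPos A.r s

/-- The strand `s` meets the line of direction `t`. -/
def Present (s : V × ℤ) (t : ℝ) : Prop := A.birth s ≤ t ∧ t ≤ A.death s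

/-- `s` and `s'` are consecutive strands, in this order, on the line of direction `t`. -/
def Consec (s s' : V × ℤ) (t : ℝ) : Prop :=
  A.Present s t ∧ A.Present s' t ∧ A.pos s < A.pos s' ∧
    ∀ w, A.Present w t → A.pos s < A.pos w → ¬ A.pos w < A.pos s'

/-- `s` is the last strand on the line of direction `t`. -/
def Top (s : V × ℤ) (t : ℝ) : Prop :=
  A.Present s t ∧ ∀ w, A.Present w t → A.pos w ≤ A.pos s

lemma int_eq_of_mul_pi {m l : ℤ} (h : (m : ℝ) * Real.pi = l * Real.pi) : m = l := by
  exact_mod_cast mul_right_cancel₀ Real.pi_ne_zero h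

lemma birth_injective : Function.Injective A.birth := by
  rintro ⟨v, m⟩ ⟨w, l⟩ h
  simp only [birth] at h
  obtain rfl := A.a_inj v w (l - m) (by push_cast; linarith)
  rw [int_eq_of_mul_pi (m := m) (l := l) (by linarith)]

lemma death_injective : Function.Injective A.death := by
  rintro ⟨v, m⟩ ⟨w, l⟩ h
  simp only [death] at h
  obtain rfl := A.b_inj v w (l - m) (by push_cast; linarith)
  rw [int_eq_of_mul_pi (m := m) (l := l) (by linarith)]

lemma birth_ne_death (s s' : V × ℤ) : A.birth s ≠ A.death s' := by
  intro h
  simp only [birth, death] at h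
  exact A.a_ne_b s.1 s'.1 (s'.2 - s.2) (by push_cast; linarith)

lemma birth_lt_death (s : V × ℤ) : A.birth s < A.death s := by
  have := A.a_lt_b s.1
  simp only [birth, death]; linarith

lemma death_lt (s : V × ℤ) : A.death s < A.birth s + 2 * Real.pi := by
  have := A.b_lt s.1
  simp only [birth, death]; linarith

lemma pos_even {v : V} {m : ℤ} (h : Even m) : A.pos (v, m) = A.r v := by
  simp [pos, strandPos, h.neg_one_zpow]

lemma pos_odd {v : V} {m : ℤ} (h : Odd m) : A.pos (v, m) = -A.r v := by
  simp [pos, strandPos, h.neg_one_zpow]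

lemma abs_pos (s : V × ℤ) : |A.pos s| = A.r s.1 := by
  obtain ⟨v, m⟩ := s
  rcases Int.even_or_odd m with h | h
  · rw [A.pos_even h, abs_of_pos (A.r_pos v)]
  · rw [A.pos_odd h, abs_neg, abs_of_pos (A.r_pos v)]

/-- Two strands of one arc with a common direction have opposite signs. -/
lemma abs_sub_lt_two {v : V} {m l : ℤ} {t : ℝ} (h : A.Present (v, m) t)
    (h' : A.Present (v, l) t) : |m - l| < 2 := by
  have h1 := A.b_lt v
  simp only [Present, birth, death] at h h'
  have hπ := Real.pi_pos
  rw [abs_lt]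
  constructor
  · by_contra hc
    have : (m : ℝ) + 2 ≤ l := by exact_mod_cast (by omega : m + 2 ≤ l)
    nlinarith
  · by_contra hc
    have : (l : ℝ) + 2 ≤ m := by exact_mod_cast (by omega : l + 2 ≤ m)
    nlinarith

/-- Equal coordinates give equal radii, hence one arc, and indices of equal parity. As an arc is
shorter than a full turn, these indices differ by less than `2`. -/
lemma eq_of_pos_eq {s s' : V × ℤ} {t : ℝ} (h : A.Present s t) (h' : A.Present s' t)
    (hpos : A.pos s = A.pos s') : s = s' := by
  have hv : s.1 = s'.1 := A.r_inj (by rw [← A.abs_pos, ← A.abs_pos, hpos])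
  obtain ⟨v, m⟩ := s
  obtain ⟨w, l⟩ := s'
  simp only at hv
  subst hv
  have h2 := A.abs_sub_lt_two h h'
  rw [abs_lt] at h2
  have hr := A.r_pos v
  have : m = l := by
    rcases Int.even_or_odd m with hm | hm <;> rcases Int.even_or_odd l with hl | hl
    · obtain ⟨i, hi⟩ := hm; obtain ⟨j, hj⟩ := hl; omega
    · rw [A.pos_even hm, A.pos_odd hl] at hpos; linarith
    · rw [A.pos_odd hm, A.pos_even hl] at hpos; linarith
    · obtain ⟨i, hi⟩ := hm; obtain ⟨j, hj⟩ := hl; omega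
  rw [this]

lemma pos_ne {s s' : V × ℤ} {t : ℝ} (h : A.Present s t) (h' : A.Present s' t) (hne : s ≠ s') :
    A.pos s ≠ A.pos s' := fun hpos => hne (A.eq_of_pos_eq h h' hpos)

/-- There are infinitely many strands; finiteness in a bounded window allows a first or last event
to be chosen. -/
lemma finite_overlap [Finite V] (c d : ℝ) :
    {s : V × ℤ | A.birth s ≤ d ∧ c ≤ A.death s}.Finite := by
  have : {s : V × ℤ | A.birth s ≤ d ∧ c ≤ A.death s} ⊆
      ⋃ v : V, Prod.mk v '' Set.Icc ⌈(A.a v - d) / Real.pi⌉ ⌊(A.b v - c) / Real.pi⌋ := by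
    rintro ⟨v, m⟩ ⟨h1, h2⟩
    simp only [birth, death] at h1 h2
    refine Set.mem_iUnion.2 ⟨v, m, ⟨?_, ?_⟩, rfl⟩
    · rw [Int.ceil_le, div_le_iff₀ Real.pi_pos]; linarith
    · rw [Int.le_floor, le_div_iff₀ Real.pi_pos]; linarith
  exact (Set.finite_iUnion fun v => (Set.finite_Icc _ _).image _).subset this

/-! ### Turning a line by multiples of `π` -/

/-- The strand that plays the role of `s` after a rotation by `j * π`. -/
def shift (j : ℤ) (s : V × ℤ) : V × ℤ := (s.1, s.2 + j)

@[simp] lemma shift_shift_neg (j : ℤ) (s : V × ℤ) : shift j (shift (-j) s) = s := by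
  simp [shift]

@[simp] lemma shift_neg_shift (j : ℤ) (s : V × ℤ) : shift (-j) (shift j s) = s := by
  simp [shift]

lemma birth_shift (j : ℤ) (s : V × ℤ) : A.birth (shift j s) = A.birth s - j * Real.pi := by
  simp only [birth, shift]; push_cast; ring

lemma death_shift (j : ℤ) (s : V × ℤ) : A.death (shift j s) = A.death s - j * Real.pi := by
  simp only [death, shift]; push_cast; ring

lemma present_shift (j : ℤ) (s : V × ℤ) (t : ℝ) :
    A.Present (shift j s) (t - j * Real.pi) ↔ A.Present s t := by
  simp [Present, birth_shift, death_shift]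

lemma pos_shift_even {j : ℤ} (hj : Even j) (s : V × ℤ) : A.pos (shift j s) = A.pos s := by
  simp [pos, strandPos, shift, zpow_add₀, hj.neg_one_zpow]

lemma pos_shift_odd {j : ℤ} (hj : Odd j) (s : V × ℤ) : A.pos (shift j s) = -A.pos s := by
  simp [pos, strandPos, shift, zpow_add₀, hj.neg_one_zpow]

lemma Consec.shift_even {s s' : V × ℤ} {t : ℝ} (h : A.Consec s s' t) {j : ℤ} (hj : Even j) :
    A.Consec (shift j s) (shift j s') (t - j * Real.pi) := by
  obtain ⟨h1, h2, h3, h4⟩ := h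
  refine ⟨(A.present_shift ..).2 h1, (A.present_shift ..).2 h2, ?_, ?_⟩
  · rwa [A.pos_shift_even hj, A.pos_shift_even hj]
  · intro w hw
    rw [← shift_shift_neg j w] at hw ⊢
    rw [present_shift] at hw
    rw [A.pos_shift_even hj, A.pos_shift_even hj, A.pos_shift_even hj]
    exact h4 _ hw

/-- A half turn reverses the line, so the two neighbours change places. -/
lemma Consec.shift_odd {s s' : V × ℤ} {t : ℝ} (h : A.Consec s s' t) {j : ℤ} (hj : Odd j) :
    A.Consec (shift j s') (shift j s) (t - j * Real.pi) := by
  obtain ⟨h1, h2, h3, h4⟩ := h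
  refine ⟨(A.present_shift ..).2 h2, (A.present_shift ..).2 h1, ?_, ?_⟩
  · rw [A.pos_shift_odd hj, A.pos_shift_odd hj]; linarith
  · intro w hw
    rw [← shift_shift_neg j w] at hw ⊢
    rw [present_shift] at hw
    rw [A.pos_shift_odd hj, A.pos_shift_odd hj, A.pos_shift_odd hj]
    intro h5 h6
    exact h4 _ hw (by linarith) (by linarith)

lemma Consec.left_unique {s s' w : V × ℤ} {t : ℝ} (h : A.Consec s w t) (h' : A.Consec s' w t) :
    s = s' := by
  refine A.eq_of_pos_eq h.1 h'.1 (le_antisymm ?_ ?_)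
  · exact not_lt.1 fun hlt => h'.2.2.2 _ h.1 hlt h.2.2.1
  · exact not_lt.1 fun hlt => h.2.2.2 _ h'.1 hlt h'.2.2.1

lemma Consec.right_unique {s s' w : V × ℤ} {t : ℝ} (h : A.Consec w s t) (h' : A.Consec w s' t) :
    s = s' := by
  refine A.eq_of_pos_eq h.2.1 h'.2.1 (le_antisymm ?_ ?_)
  · exact not_lt.1 fun hlt => h.2.2.2 _ h'.2.1 h'.2.2.1 hlt
  · exact not_lt.1 fun hlt => h'.2.2.2 _ h.2.1 h.2.2.1 hlt

/-! ### Charging edges to events -/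

/-- The pair `e` is charged to an event: it appears on the outer side (`0`) or on the inner side
(`1`) of an arc when the arc begins, or it becomes visible when an arc ends (`2`). -/
def Charge (x : V × Fin 3) (e : Sym2 V) : Prop :=
  (x.2 = 0 ∧ ∃ s, s.1 ≠ x.1 ∧ A.Consec (x.1, 0) s (A.birth (x.1, 0)) ∧ e = s(x.1, s.1)) ∨
  (x.2 = 1 ∧ ∃ s, s.1 ≠ x.1 ∧ A.Consec s (x.1, 0) (A.birth (x.1, 0)) ∧ e = s(x.1, s.1)) ∨
  (x.2 = 2 ∧ ∃ s s', A.Consec s (x.1, 0) (A.death (x.1, 0)) ∧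
    A.Consec (x.1, 0) s' (A.death (x.1, 0)) ∧ e = s(s.1, s'.1))

/-- A strand has at most one neighbour on each side. -/
lemma Charge.unique {x : V × Fin 3} {e e' : Sym2 V} (h : A.Charge x e) (h' : A.Charge x e') :
    e = e' := by
  rcases h with ⟨hx, s, -, hs, rfl⟩ | ⟨hx, s, -, hs, rfl⟩ | ⟨hx, s, p, hs, hp, rfl⟩ <;>
  rcases h' with ⟨hx', s', -, hs', rfl⟩ | ⟨hx', s', -, hs', rfl⟩ | ⟨hx', s', p', hs', hp', rfl⟩ <;>
  first
    | (exfalso; rw [hx] at hx'; revert hx'; decide)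
    | skip
  · rw [hs.right_unique A hs']
  · rw [hs.left_unique A hs']
  · rw [hs.left_unique A hs', hp.right_unique A hp']

/-- The side of the beginning of the arc of `s` that looks towards larger coordinates. -/
def upSlot (s : V × ℤ) : V × Fin 3 := (s.1, if Even s.2 then 0 else 1)

/-- The side of the beginning of the arc of `s` that looks towards smaller coordinates. -/
def downSlot (s : V × ℤ) : V × Fin 3 := (s.1, if Even s.2 then 1 else 0)

/-- Turning by `m * π` brings the strand to index `0`. For odd `m` the line is reversed, and the
inner side of the arc faces larger coordinates. -/
lemma charge_upSlot {s : V × ℤ} {e : Sym2 V} : A.Charge (upSlot s) e ↔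
    ∃ s', s'.1 ≠ s.1 ∧ A.Consec s s' (A.birth s) ∧ e = s(s.1, s'.1) := by
  obtain ⟨v, m⟩ := s
  have hb : A.birth (v, m) - (-m : ℤ) * Real.pi = A.birth (v, 0) := by simp [birth]
  have hb' : A.birth (v, 0) - m * Real.pi = A.birth (v, m) := by simp [birth]
  have hs : shift (-m) (v, m) = (v, 0) := by simp [shift]
  have hs' : shift m (v, 0) = (v, m) := by simp [shift]
  by_cases h : Even m
  · simp only [upSlot, if_pos h, Charge]
    constructor
    · rintro (⟨-, s, hne, hc, he⟩ | ⟨h0, -⟩ | ⟨h0, -⟩)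
      · refine ⟨shift m s, hne, ?_, he⟩
        have := hc.shift_even A h
        rwa [hb', hs'] at this
      · exact absurd h0 (by decide)
      · exact absurd h0 (by decide)
    · rintro ⟨s, hne, hc, he⟩
      refine Or.inl ⟨trivial, shift (-m) s, hne, ?_, he⟩
      have := hc.shift_even A h.neg
      rwa [hb, hs] at this
  · simp only [upSlot, if_neg h, Charge]
    have h' := Int.not_even_iff_odd.1 h
    constructor
    · rintro (⟨h0, -⟩ | ⟨-, s, hne, hc, he⟩ | ⟨h0, -⟩)
      · exact absurd h0 (by decide)
      · refine ⟨shift m s, hne, ?_, he⟩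
        have := hc.shift_odd A h'
        rwa [hb', hs'] at this
      · exact absurd h0 (by decide)
    · rintro ⟨s, hne, hc, he⟩
      refine Or.inr (Or.inl ⟨trivial, shift (-m) s, hne, ?_, he⟩)
      have := hc.shift_odd A h'.neg
      rwa [hb, hs] at this

lemma downSlot_eq (s : V × ℤ) : downSlot s = upSlot (shift 1 s) := by
  by_cases h : Even s.2 <;> simp [downSlot, upSlot, shift, h]

lemma charge_downSlot {s : V × ℤ} {e : Sym2 V} : A.Charge (downSlot s) e ↔
    ∃ s', s'.1 ≠ s.1 ∧ A.Consec s' s (A.birth s) ∧ e = s(s.1, s'.1) := by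
  rw [downSlot_eq, charge_upSlot]
  constructor
  · rintro ⟨s', hne, hc, he⟩
    refine ⟨shift (-1) s', hne, ?_, he⟩
    have := hc.shift_odd A (j := -1) (by decide)
    rwa [shift_neg_shift, birth_shift,
      show A.birth s - (1 : ℤ) * Real.pi - (-1 : ℤ) * Real.pi = A.birth s by push_cast; ring] at this
  · rintro ⟨s', hne, hc, he⟩
    refine ⟨shift 1 s', hne, ?_, he⟩
    have := hc.shift_odd A (j := 1) (by decide)
    rwa [birth_shift]

lemma charge_death {w : V × ℤ} {e : Sym2 V} : A.Charge (w.1, 2) e ↔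
    ∃ s s', A.Consec s w (A.death w) ∧ A.Consec w s' (A.death w) ∧ e = s(s.1, s'.1) := by
  obtain ⟨v, m⟩ := w
  have hb : A.death (v, m) - (-m : ℤ) * Real.pi = A.death (v, 0) := by simp [death]
  have hb' : A.death (v, 0) - m * Real.pi = A.death (v, m) := by simp [death]
  have hs : shift (-m) (v, m) = (v, 0) := by simp [shift]
  have hs' : shift m (v, 0) = (v, m) := by simp [shift]
  simp only [Charge]
  constructor
  · rintro (⟨h0, -⟩ | ⟨h0, -⟩ | ⟨-, s, s', h1, h2, he⟩)
    · exact absurd h0 (by decide)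
    · exact absurd h0 (by decide)
    · rcases Int.even_or_odd m with h | h
      · have h1' := h1.shift_even A h
        have h2' := h2.shift_even A h
        rw [hb', hs'] at h1' h2'
        exact ⟨_, _, h1', h2', he⟩
      · have h1' := h1.shift_odd A h
        have h2' := h2.shift_odd A h
        rw [hb', hs'] at h1' h2'
        exact ⟨_, _, h2', h1', he.trans Sym2.eq_swap⟩
  · rintro ⟨s, s', h1, h2, he⟩
    refine Or.inr (Or.inr ⟨trivial, ?_⟩)
    rcases Int.even_or_odd m with h | h
    · have h1' := h1.shift_even A h.neg
      have h2' := h2.shift_even A h.neg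
      rw [hb, hs] at h1' h2'
      exact ⟨_, _, h1', h2', he⟩
    · have h1' := h1.shift_odd A h.neg
      have h2' := h2.shift_odd A h.neg
      rw [hb, hs] at h1' h2'
      exact ⟨_, _, h2', h1', he.trans Sym2.eq_swap⟩

lemma Top.not_charge_upSlot {s : V × ℤ} (h : A.Top s (A.birth s)) (e : Sym2 V) :
    ¬ A.Charge (upSlot s) e := by
  rw [charge_upSlot]
  rintro ⟨s', -, hc, -⟩
  exact (h.2 s' hc.2.1).not_gt hc.2.2.1

lemma Top.not_charge_death {s : V × ℤ} (h : A.Top s (A.death s)) (e : Sym2 V) :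
    ¬ A.Charge (s.1, 2) e := by
  rw [charge_death]
  rintro ⟨-, s', -, hc, -⟩
  exact (h.2 s' hc.2.1).not_gt hc.2.2.1

/-- Turning a line of sight backwards, one meets the beginning of one of its two arcs or the end of
an arc that separates them. -/
lemma Consec.exists_event [Finite V] {s s' : V × ℤ} {t : ℝ} (h : A.Consec s s' t) :
    (A.Consec s s' (A.birth s)) ∨ (A.Consec s s' (A.birth s')) ∨
      ∃ w, A.Consec s w (A.death w) ∧ A.Consec w s' (A.death w) := by
  obtain ⟨⟨h1, h2⟩, ⟨h3, h4⟩, hlt, hno⟩ := h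
  set c := max (A.birth s) (A.birth s') with hc
  have hct : c ≤ t := max_le h1 h3
  -- the ends between `c` and `t` of the separating strands
  set S := {w : V × ℤ | c ≤ A.death w ∧ A.death w < t ∧ A.pos s < A.pos w ∧ A.pos w < A.pos s'}
    with hS
  have hfin : S.Finite := (A.finite_overlap c t).subset fun w hw =>
    ⟨(A.birth_lt_death w).le.trans hw.2.1.le, hw.1⟩
  have hblock : ∀ w τ, c ≤ τ → τ ≤ t → A.Present w τ → A.pos s < A.pos w → A.pos w < A.pos s' →
      w ∈ S := by
    intro w τ hcτ hτt hw hw1 hw2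
    refine ⟨hcτ.trans hw.2, ?_, hw1, hw2⟩
    by_contra hcon
    exact hno w ⟨hw.1.trans hτt, not_lt.1 hcon⟩ hw1 hw2
  rcases S.eq_empty_or_nonempty with hemp | hne
  · have hcons : A.Consec s s' c := by
      refine ⟨⟨le_max_left _ _, hct.trans h2⟩, ⟨le_max_right _ _, hct.trans h4⟩, hlt, ?_⟩
      intro w hw hw1 hw2
      have := hblock w c le_rfl hct hw hw1 hw2
      rw [hemp] at this
      exact this
    rcases max_choice (A.birth s) (A.birth s') with hm | hm
    · exact Or.inl (by rwa [hc, hm] at hcons)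
    · exact Or.inr (Or.inl (by rwa [hc, hm] at hcons))
  -- At the last such end, any other separating strand would lie in `S` and so end there too,
  -- against general position.
  · obtain ⟨w, hwS, hmax⟩ := Set.exists_max_image S A.death hfin hne
    have hu : ∀ w', A.Present w' (A.death w) → A.pos s < A.pos w' → A.pos w' < A.pos s' →
        w' = w := by
      intro w' hw' hw1 hw2
      have hw'S := hblock w' _ hwS.1 hwS.2.1.le hw' hw1 hw2
      exact A.death_injective (le_antisymm (hmax w' hw'S) hw'.2)
    have hps : A.Present s (A.death w) :=
      ⟨(le_max_left _ _).trans hwS.1, hwS.2.1.le.trans h2⟩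
    have hps' : A.Present s' (A.death w) :=
      ⟨(le_max_right _ _).trans hwS.1, hwS.2.1.le.trans h4⟩
    have hpw : A.Present w (A.death w) := ⟨(A.birth_lt_death w).le, le_rfl⟩
    refine Or.inr (Or.inr ⟨w, ⟨hps, hpw, hwS.2.2.1, ?_⟩, ⟨hpw, hps', hwS.2.2.2, ?_⟩⟩)
    · intro w' hw' hw1 hw2
      rw [hu w' hw' hw1 (hw2.trans hwS.2.2.2)] at hw2
      exact lt_irrefl _ hw2
    · intro w' hw' hw1 hw2
      rw [hu w' hw' (hwS.2.2.1.trans hw1) hw2] at hw1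
      exact lt_irrefl _ hw1

end GenericArcs

namespace GenericArcs

variable {V : Type*} (A : GenericArcs V)

lemma Consec.exists_charge [Finite V] {s s' : V × ℤ} {t : ℝ} (h : A.Consec s s' t)
    (hne : s.1 ≠ s'.1) : ∃ x, A.Charge x s(s.1, s'.1) := by
  rcases h.exists_event with h | h | ⟨w, h, h'⟩
  · exact ⟨_, A.charge_upSlot.2 ⟨s', hne.symm, h, rfl⟩⟩
  · exact ⟨_, A.charge_downSlot.2 ⟨s, hne, h, Sym2.eq_swap⟩⟩
  · exact ⟨_, A.charge_death.2 ⟨s, s', h, h', rfl⟩⟩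

/-- If some line meets no arc (except at ends), then an arc begins on a line that meets no other
arc. -/
lemma exists_alone_at_birth [Finite V] [Nonempty V] {t : ℝ}
    (ht : ∀ s, A.birth s ≤ t → ¬ t < A.death s) :
    ∃ s, ∀ s', A.Present s' (A.birth s) → s' = s := by
  set S := {s : V × ℤ | t < A.birth s ∧ A.birth s ≤ t + Real.pi} with hS
  have hfin : S.Finite := (A.finite_overlap t (t + Real.pi)).subset fun s hs =>
    ⟨hs.2, (hs.1.trans (A.birth_lt_death s)).le⟩
  have hne : S.Nonempty := by
    obtain ⟨v⟩ := ‹Nonempty V›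
    have h1 := Int.floor_le ((A.a v - t) / Real.pi)
    have h2 := Int.lt_floor_add_one ((A.a v - t) / Real.pi)
    have h3 := Int.ceil_lt_add_one ((A.a v - t) / Real.pi)
    have h4 := Int.le_ceil ((A.a v - t) / Real.pi)
    rw [div_le_iff₀ Real.pi_pos] at h4
    rw [← sub_lt_iff_lt_add, lt_div_iff₀ Real.pi_pos] at h3
    -- The largest index whose beginning is still strictly after `t`.
    refine ⟨(v, ⌈(A.a v - t) / Real.pi⌉ - 1), ?_, ?_⟩ <;> simp only [birth] <;> push_cast <;>
      linarith
  obtain ⟨s, hs, hmin⟩ := Set.exists_min_image S A.birth hfin hne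
  refine ⟨s, fun s' hs' => ?_⟩
  have h1 : t < A.birth s' := by
    by_contra hcon
    exact ht s' (not_lt.1 hcon) (hs.1.trans_le hs'.2)
  exact A.birth_injective (le_antisymm hs'.1 (hmin s' ⟨h1, hs'.1.trans hs.2⟩))

/-- Both sides of the beginning are empty; the inner slot is recorded because it differs from the
two slots already lost by the outermost arc. -/
lemma not_charge_of_alone {s : V × ℤ} (h : ∀ s', A.Present s' (A.birth s) → s' = s)
    (e : Sym2 V) : ¬ A.Charge (s.1, 1) e := by
  by_cases hs : Even s.2
  · have : (s.1, (1 : Fin 3)) = downSlot s := by simp [downSlot, hs]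
    rw [this, charge_downSlot]
    rintro ⟨s', hne, hc, -⟩
    exact hne (by rw [h s' hc.1])
  · have : (s.1, (1 : Fin 3)) = upSlot s := by simp [upSlot, hs]
    rw [this, charge_upSlot]
    rintro ⟨s', hne, hc, -⟩
    exact hne (by rw [h s' hc.2.1])

/-! ### The outermost arc and the three lost slots -/

section MaxRadius

variable {A} {u : V} (hu : ∀ v, A.r v ≤ A.r u)
include hu

lemma pos_le_of_max {m : ℤ} (hm : Even m) (s : V × ℤ) : A.pos s ≤ A.pos (u, m) := by
  rw [A.pos_even hm]
  exact (le_abs_self _).trans ((A.abs_pos s).le.trans (hu _))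

lemma le_pos_of_max {m : ℤ} (hm : Odd m) (s : V × ℤ) : A.pos (u, m) ≤ A.pos s := by
  rw [A.pos_odd hm]
  exact neg_le_of_abs_le ((A.abs_pos s).le.trans (hu _))

lemma not_charge_outer_of_max (e : Sym2 V) : ¬ A.Charge (u, 0) e :=
  Top.not_charge_upSlot A (s := (u, 0))
    ⟨⟨le_rfl, (A.birth_lt_death _).le⟩, fun w _ => pos_le_of_max hu (by decide) w⟩ e

lemma not_charge_death_of_max (e : Sym2 V) : ¬ A.Charge (u, 2) e :=
  Top.not_charge_death A (s := (u, 0))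
    ⟨⟨(A.birth_lt_death _).le, le_rfl⟩, fun w _ => pos_le_of_max hu (by decide) w⟩ e

omit hu in
/-- Outside its own angular range, an arc appears only on the opposite side of the centre. -/
lemma death_le_or_le_birth {m : ℤ} (hm : Even m) :
    A.death (u, m) ≤ A.death (u, 0) ∨ A.birth (u, -2) ≤ A.birth (u, m) := by
  obtain ⟨j, rfl⟩ := hm
  have hπ := Real.pi_pos
  simp only [birth, death]
  push_cast
  rcases le_or_gt 0 j with hj | hj
  · left
    have : (0 : ℝ) ≤ j := by exact_mod_cast hj
    nlinarith
  · right
    have : (j : ℝ) ≤ -1 := by exact_mod_cast (by omega : j ≤ -1)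
    nlinarith

/-- The third slot that is lost, or the arc that is seen by the outermost one on both sides. -/
lemma exists_third [Finite V] :
    (∃ x : V × Fin 3, x ≠ (u, 0) ∧ x ≠ (u, 2) ∧ ∀ e, ¬ A.Charge x e) ∨
      ∃ s : V × ℤ, A.Consec s (u, 0) (A.death (u, 0)) ∧
        A.Consec s (u, -2) (A.birth (u, -2)) := by
  have : Nonempty V := ⟨u⟩
  by_cases hempty : ∃ t, ∀ s, A.birth s ≤ t → ¬ t < A.death s
  · obtain ⟨t, ht⟩ := hempty
    obtain ⟨s, hs⟩ := A.exists_alone_at_birth ht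
    exact Or.inl ⟨(s.1, 1), by simp, by simp, A.not_charge_of_alone hs⟩
  push Not at hempty
  -- Between `lo` and `hi` the outermost arc is missing from the positive half of the line; index
  -- `-2` is the same arc one full turn later.
  set lo := A.death (u, 0) with hlo
  set hi := A.birth (u, -2) with hhi
  have hlohi : lo < hi := by
    have := A.b_lt u
    simp only [hlo, hhi, death, birth]; push_cast; linarith
  obtain ⟨t, hlt, hth⟩ := exists_between hlohi
  have hfin : {s | A.Present s t}.Finite := A.finite_overlap t t
  obtain ⟨s, hst, hmax⟩ := Set.exists_max_image _ A.pos hfin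
    (by obtain ⟨s, h1, h2⟩ := hempty t; exact ⟨s, h1, h2.le⟩)
  simp only [Set.mem_ofPred_eq] at hst hmax
  have hodd : ∀ m, A.Present (u, m) t → ¬ Even m := by
    intro m h hm
    rcases death_le_or_le_birth (A := A) (u := u) hm with h' | h'
    · exact absurd (h.2.trans h') (not_le.2 hlt)
    · exact absurd (h'.trans h.1) (not_le.2 hth)
  have habove : ∀ w, A.pos s < A.pos w → ¬ A.Present w t := fun w hw hp =>
    (hmax w hp).not_gt hw
  by_cases hlost : ∃ x : V × Fin 3, x ≠ (u, 0) ∧ x ≠ (u, 2) ∧ ∀ e, ¬ A.Charge x e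
  · exact Or.inl hlost
  refine Or.inr ⟨s, ?_⟩
  push Not at hlost
  -- the top strand `s` neither begins nor ends in the gap, and no strand above it does
  have hup : ∀ w, lo < A.birth w → A.birth w < hi → ¬ A.Top w (A.birth w) := by
    intro w h1 h2 htop
    obtain ⟨e, he⟩ := hlost (upSlot w) (by
      intro h
      have hw : w.1 = u := congrArg Prod.fst h
      obtain ⟨v, m⟩ := w
      simp only at hw
      subst hw
      -- An even strand of `u` cannot begin in the gap; the up slot of an odd one is its inner slot,
      -- not among the two excluded.
      by_cases hm : Even m
      · rcases death_le_or_le_birth (A := A) (u := v) hm with h' | h'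
        · exact absurd ((h1.trans (A.birth_lt_death _)).trans_le h') (lt_irrefl _)
        · exact absurd (h2.trans_le h') (lt_irrefl _)
      · simp [upSlot, hm] at h) (by
      intro h
      have := congrArg Prod.snd h
      by_cases hm : Even w.2 <;> simp [upSlot, hm] at this)
    exact htop.not_charge_upSlot A e he
  have hdown : ∀ w, lo < A.death w → A.death w < hi → ¬ A.Top w (A.death w) := by
    intro w h1 h2 htop
    -- In the gap `u` occurs only at the bottom of the line. If it is also on top it is alone, and
    -- its end would leave an empty line.
    by_cases hw : w.1 = u
    · obtain ⟨v, m⟩ := w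
      simp only at hw
      subst hw
      have hm : Odd m := by
        rw [← Int.not_even_iff_odd]
        intro hm
        rcases death_le_or_le_birth (A := A) (u := v) hm with h' | h'
        · exact absurd (h1.trans_le h') (lt_irrefl _)
        · exact absurd ((h'.trans_lt (A.birth_lt_death _)).trans h2) (lt_irrefl _)
      obtain ⟨s', h3, h4⟩ := hempty (A.death (v, m))
      have := A.eq_of_pos_eq ⟨h3, h4.le⟩ htop.1
        (le_antisymm (htop.2 s' ⟨h3, h4.le⟩) (le_pos_of_max hu hm s'))
      rw [this] at h4
      exact lt_irrefl _ h4
    · obtain ⟨e, he⟩ := hlost (w.1, 2) (by simp) (by simpa using hw)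
      exact htop.not_charge_death A e he
  have hbt : A.birth s < t := by
    refine hst.1.lt_of_ne fun h => hup s (h ▸ hlt) (h ▸ hth) ?_
    rw [h]
    exact ⟨hst, hmax⟩
  have htd : t < A.death s := by
    refine hst.2.lt_of_ne fun h => hdown s (h ▸ hlt) (h ▸ hth) ?_
    rw [← h]
    exact ⟨hst, hmax⟩
  have hborn : ∀ w τ, t ≤ τ → A.Present w τ → A.pos s < A.pos w → t < A.birth w :=
    fun w τ hτ hw hpos => not_le.1 fun h => habove w hpos ⟨h, hτ.trans hw.2⟩
  have hdied : ∀ w τ, τ ≤ t → A.Present w τ → A.pos s < A.pos w → A.death w < t :=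
    fun w τ hτ hw hpos => not_le.1 fun h => habove w hpos ⟨hw.1.trans hτ, h⟩
  have hfwd : hi ≤ A.death s ∧ ∀ w, A.pos s < A.pos w → t < A.birth w → hi ≤ A.birth w := by
    -- The events that could displace `s` from the top. At the first of them the strand beginning or
    -- ending is itself on top, which `hup` and `hdown` exclude.
    set S := {τ : ℝ | t < τ ∧ τ < hi ∧ (τ = A.death s ∨ ∃ w, A.pos s < A.pos w ∧ τ = A.birth w)}
      with hS
    have hSfin : S.Finite := by
      refine (((A.finite_overlap t hi).image A.birth).union
        (Set.finite_singleton (A.death s))).subset ?_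
      rintro τ ⟨h1, h2, rfl | ⟨w, -, rfl⟩⟩
      · exact Or.inr rfl
      · exact Or.inl ⟨w, ⟨h2.le, (h1.trans (A.birth_lt_death w)).le⟩, rfl⟩
    have hemp : ∀ τ, τ ∉ S := by
      rw [← Set.eq_empty_iff_forall_notMem]
      by_contra hne
      obtain ⟨τ, ⟨hτ, hτ', hcase⟩, hmin⟩ :=
        Set.exists_min_image S id hSfin (Set.nonempty_iff_ne_empty.2 hne)
      have hmin' : ∀ w, A.Present w τ → A.pos s < A.pos w → A.birth w = τ := fun w hw hpos =>
        le_antisymm hw.1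
          (hmin _ ⟨hborn w τ hτ.le hw hpos, hw.1.trans_lt hτ', Or.inr ⟨w, hpos, rfl⟩⟩)
      rcases hcase with rfl | ⟨w, hw, rfl⟩
      · refine hdown s (hlt.trans hτ) hτ' ⟨⟨(A.birth_lt_death s).le, le_rfl⟩, fun w hw => ?_⟩
        by_contra hcon
        exact A.birth_ne_death w s (hmin' w hw (not_le.1 hcon))
      · refine hup w (hlt.trans hτ) hτ' ⟨⟨le_rfl, (A.birth_lt_death w).le⟩, fun w' hw' => ?_⟩
        by_contra hcon
        have hlt' := not_le.1 hcon
        rw [A.birth_injective (hmin' w' hw' (hw.trans hlt'))] at hlt'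
        exact lt_irrefl _ hlt'
    refine ⟨?_, fun w hw hw' => ?_⟩
    · by_contra hcon
      exact hemp _ ⟨htd, not_le.1 hcon, Or.inl rfl⟩
    · by_contra hcon
      exact hemp _ ⟨hw', not_le.1 hcon, Or.inr ⟨w, hw, rfl⟩⟩
  have hbwd : A.birth s ≤ lo ∧ ∀ w, A.pos s < A.pos w → A.death w < t → A.death w ≤ lo := by
    set S := {τ : ℝ | lo < τ ∧ τ < t ∧ (τ = A.birth s ∨ ∃ w, A.pos s < A.pos w ∧ τ = A.death w)}
      with hS
    have hSfin : S.Finite := by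
      refine (((A.finite_overlap lo t).image A.death).union
        (Set.finite_singleton (A.birth s))).subset ?_
      rintro τ ⟨h1, h2, rfl | ⟨w, -, rfl⟩⟩
      · exact Or.inr rfl
      · exact Or.inl ⟨w, ⟨((A.birth_lt_death w).trans h2).le, h1.le⟩, rfl⟩
    have hemp : ∀ τ, τ ∉ S := by
      rw [← Set.eq_empty_iff_forall_notMem]
      by_contra hne
      obtain ⟨τ, ⟨hτ, hτ', hcase⟩, hmax'⟩ :=
        Set.exists_max_image S id hSfin (Set.nonempty_iff_ne_empty.2 hne)
      have hmax'' : ∀ w, A.Present w τ → A.pos s < A.pos w → A.death w = τ := fun w hw hpos =>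
        le_antisymm
          (hmax' _ ⟨hτ.trans_le hw.2, hdied w τ hτ'.le hw hpos, Or.inr ⟨w, hpos, rfl⟩⟩) hw.2
      rcases hcase with rfl | ⟨w, hw, rfl⟩
      · refine hup s hτ (hτ'.trans hth) ⟨⟨le_rfl, (A.birth_lt_death s).le⟩, fun w hw => ?_⟩
        by_contra hcon
        exact A.birth_ne_death s w (hmax'' w hw (not_le.1 hcon)).symm
      · refine hdown w hτ (hτ'.trans hth) ⟨⟨(A.birth_lt_death w).le, le_rfl⟩, fun w' hw' => ?_⟩
        by_contra hcon
        have hlt' := not_le.1 hcon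
        rw [A.death_injective (hmax'' w' hw' (hw.trans hlt'))] at hlt'
        exact lt_irrefl _ hlt'
    refine ⟨?_, fun w hw hw' => ?_⟩
    · by_contra hcon
      exact hemp _ ⟨not_le.1 hcon, hbt, Or.inl rfl⟩
    · by_contra hcon
      exact hemp _ ⟨not_le.1 hcon, hw', Or.inr ⟨w, hw, rfl⟩⟩
  have hne : ∀ m, Even m → s ≠ (u, m) := by
    rintro m hm rfl
    exact hodd m hst hm
  constructor
  · have hps : A.Present s lo := ⟨hbwd.1, hlt.le.trans htd.le⟩
    have hpu : A.Present (u, 0) lo := ⟨(A.birth_lt_death _).le, le_rfl⟩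
    refine ⟨hps, hpu, (pos_le_of_max hu (by decide) s).lt_of_ne
      (A.pos_ne hps hpu (hne 0 (by decide))), fun w hw hpos hlt' => ?_⟩
    have := le_antisymm (hbwd.2 w hpos (hdied w lo hlt.le hw hpos)) hw.2
    rw [A.death_injective this] at hlt'
    exact lt_irrefl _ hlt'
  · have hps : A.Present s hi := ⟨hbt.le.trans hth.le, hfwd.1⟩
    have hpu : A.Present (u, -2) hi := ⟨le_rfl, (A.birth_lt_death _).le⟩
    refine ⟨hps, hpu, (pos_le_of_max hu (by decide) s).lt_of_ne
      (A.pos_ne hps hpu (hne (-2) (by decide))), fun w hw hpos hlt' => ?_⟩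
    have := le_antisymm hw.1 (hfwd.2 w hpos (hborn w hi hth.le hw hpos))
    rw [A.birth_injective this] at hlt'
    exact lt_irrefl _ hlt'

end MaxRadius

/-- Three slots are not needed to charge all the edges. -/
theorem exists_lost_slots [Finite V] [Nonempty V] :
    ∃ X : Finset (V × Fin 3), X.card = 3 ∧ ∀ s s' t, A.Consec s s' t → s.1 ≠ s'.1 →
      ∃ x ∉ X, A.Charge x s(s.1, s'.1) := by
  classical
  obtain ⟨u, hu⟩ := Finite.exists_max A.r
  rcases exists_third hu with ⟨x, hx0, hx2, hx⟩ | ⟨⟨v, k⟩, hlo, hhi⟩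
  · refine ⟨{x, (u, 0), (u, 2)}, ?_, fun s s' t h hne => ?_⟩
    · rw [Finset.card_insert_of_notMem (by simp [hx0, hx2]), Finset.card_pair (by simp)]
    · obtain ⟨y, hy⟩ := h.exists_charge A hne
      refine ⟨y, ?_, hy⟩
      simp only [Finset.mem_insert, Finset.mem_singleton]
      rintro (rfl | rfl | rfl)
      · exact hx _ hy
      · exact not_charge_outer_of_max hu _ hy
      · exact not_charge_death_of_max hu _ hy
  -- the slot that is lost because `v` is seen by `u` on both sides of the gap
  have hother : v ≠ u → ∃ y : V × Fin 3, y ≠ (u, 1) ∧ A.Charge y s(v, u) := by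
    intro hvu
    rcases hlo.exists_event with h | h | ⟨w, h, h'⟩
    · exact ⟨_, fun h' => hvu (congrArg Prod.fst h'),
        A.charge_upSlot.2 ⟨_, hvu.symm, h, rfl⟩⟩
    -- The strand of `v` would last from the beginning of `u` to its next beginning, a full turn.
    · exfalso
      have h1 := h.1.1
      have h2 := hhi.1.2
      have h3 := A.death_lt (v, k)
      have h4 : A.birth (u, -2) = A.birth (u, 0) + 2 * Real.pi := by
        simp only [birth]; push_cast; ring
      linarith
    · exact ⟨_, fun h' => absurd (congrArg Prod.snd h') (by simp),
        A.charge_death.2 ⟨_, _, h, h', rfl⟩⟩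
  -- The inner slot is read off at `(u, -2)`, whose lower neighbour is the strand of `v`. If `v =
  -- u`, the slot is empty.
  have huniq : ∀ e, A.Charge (u, 1) e → v ≠ u ∧ e = s(v, u) := by
    intro e he
    have : ((u, 1) : V × Fin 3) = downSlot (u, -2) := by simp [downSlot]
    rw [this, charge_downSlot] at he
    obtain ⟨s', hne, hc, rfl⟩ := he
    rw [hc.left_unique A hhi] at hne ⊢
    exact ⟨hne, Sym2.eq_swap⟩
  refine ⟨{(u, 1), (u, 0), (u, 2)}, ?_, fun s s' t h hne => ?_⟩
  · rw [Finset.card_insert_of_notMem (by simp), Finset.card_pair (by simp)]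
  · have : ∃ y : V × Fin 3, y ≠ (u, 1) ∧ A.Charge y s(s.1, s'.1) := by
      obtain ⟨y, hy⟩ := h.exists_charge A hne
      by_cases hyu : y = (u, 1)
      · rw [hyu] at hy
        obtain ⟨hvu, he⟩ := huniq _ hy
        rw [he]
        exact hother hvu
      · exact ⟨y, hyu, hy⟩
    obtain ⟨y, hy1, hy⟩ := this
    refine ⟨y, ?_, hy⟩
    simp only [Finset.mem_insert, Finset.mem_singleton]
    rintro (rfl | rfl | rfl)
    · exact hy1 rfl
    · exact not_charge_outer_of_max hu _ hy
    · exact not_charge_death_of_max hu _ hy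

/-! ### From sights to consecutive strands, and the count -/

/-- Two arcs with an unobstructed line of sight have consecutive strands on that line. -/
lemma exists_consec_of_sight [Finite V] {s s' : V × ℤ} {t : ℝ} (hne : s.1 ≠ s'.1)
    (h : StrandSight A.r A.a A.b s s' t) :
    ∃ p p' : V × ℤ, A.Consec p p' t ∧ s(p.1, p'.1) = s(s.1, s'.1) := by
  -- Further strands of the same two arcs may lie in between, so a closest pair of strands of these
  -- arcs is taken.
  set S := {q : (V × ℤ) × (V × ℤ) | StrandSight A.r A.a A.b q.1 q.2 t ∧ q.1.1 = s.1 ∧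
    q.2.1 = s'.1} with hS
  have hF := A.finite_overlap t t
  obtain ⟨⟨p, p'⟩, ⟨⟨hp, hp', hno⟩, h1, h2⟩, hmin⟩ := Set.exists_min_image S
    (fun q => |A.pos q.1 - A.pos q.2|)
    ((hF.prod hF).subset fun q hq => ⟨hq.1.1, hq.1.2.1⟩) ⟨(s, s'), h, rfl, rfl⟩
  simp only at h1 h2 hp hp' hno hmin
  have hpp : A.pos p ≠ A.pos p' :=
    A.pos_ne hp hp' (by rintro rfl; exact hne (h1.symm.trans h2))
  have key : ∀ w, A.Present w t → A.pos w ≠ A.pos p → A.pos w ≠ A.pos p' →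
      A.pos w ∉ Set.uIcc (A.pos p) (A.pos p') := by
    intro w hw hwp hwp' hmem
    by_cases hw1 : w.1 = p.1
    · have hlt : |A.pos w - A.pos p'| < |A.pos p - A.pos p'| := by
        rcases Set.mem_uIcc.1 hmem with ⟨h3, h4⟩ | ⟨h3, h4⟩
        · have := h3.lt_of_ne hwp.symm
          rw [abs_of_nonpos (by linarith), abs_of_nonpos (by linarith)]; linarith
        · have := h4.lt_of_ne hwp
          rw [abs_of_nonneg (by linarith), abs_of_nonneg (by linarith)]; linarith
      refine (hmin (w, p') ⟨⟨hw, hp', fun z hz hz1 hz2 hzm => ?_⟩, hw1.trans h1, h2⟩).not_gt hlt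
      exact hno z hz (hw1 ▸ hz1) hz2 (Set.uIcc_subset_uIcc_right hmem hzm)
    · by_cases hw2 : w.1 = p'.1
      · have hlt : |A.pos p - A.pos w| < |A.pos p - A.pos p'| := by
          rcases Set.mem_uIcc.1 hmem with ⟨h3, h4⟩ | ⟨h3, h4⟩
          · have := h4.lt_of_ne hwp'
            rw [abs_of_nonpos (by linarith), abs_of_nonpos (by linarith)]; linarith
          · have := h3.lt_of_ne hwp'.symm
            rw [abs_of_nonneg (by linarith), abs_of_nonneg (by linarith)]; linarith
        refine (hmin (p, w) ⟨⟨hp, hw, fun z hz hz1 hz2 hzm => ?_⟩, h1, hw2.trans h2⟩).not_gt hlt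
        exact hno z hz hz1 (hw2 ▸ hz2) (Set.uIcc_subset_uIcc_left hmem hzm)
      · exact hno w hw hw1 hw2 hmem
  rcases hpp.lt_or_gt with hlt | hlt
  · exact ⟨p, p', ⟨hp, hp', hlt, fun w hw h3 h4 => key w hw h3.ne' h4.ne
      (Set.mem_uIcc.2 (Or.inl ⟨h3.le, h4.le⟩))⟩, by rw [h1, h2]⟩
  · exact ⟨p', p, ⟨hp', hp, hlt, fun w hw h3 h4 => key w hw h4.ne h3.ne'
      (Set.mem_uIcc.2 (Or.inr ⟨h3.le, h4.le⟩))⟩, by rw [h1, h2]; exact Sym2.eq_swap⟩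

/-- A graph whose edges are all seen in a family of arcs in general position has at most `3n - 3`
edges. -/
theorem card_edges_le [Fintype V] [Nonempty V] (G : SimpleGraph V)
    (hG : ∀ u v, G.Adj u v → ∃ (t : ℝ) (k l : ℤ), StrandSight A.r A.a A.b (u, k) (v, l) t) :
    G.edgeSet.ncard ≤ 3 * Fintype.card V - 3 := by
  classical
  obtain ⟨X, hX, hch⟩ := A.exists_lost_slots
  have hex : ∀ e ∈ G.edgeSet, ∃ x ∉ X, A.Charge x e := by
    intro e
    induction e with
    | h u v =>
      intro huv
      obtain ⟨t, k, l, hs⟩ := hG u v huv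
      obtain ⟨p, p', hc, he⟩ := A.exists_consec_of_sight (SimpleGraph.Adj.ne huv) hs
      have hne : p.1 ≠ p'.1 := by
        intro h
        have : (s(u, v)).IsDiag := by
          simp only at he
          rw [← he, h]
          exact Sym2.mk_isDiag_iff.2 rfl
        exact (SimpleGraph.Adj.ne huv) (Sym2.mk_isDiag_iff.1 this)
      have := hch p p' t hc hne
      rwa [he] at this
  choose! f hfX hf using hex
  have hcard : (Xᶜ : Finset (V × Fin 3)).card = 3 * Fintype.card V - 3 := by
    rw [Finset.card_compl, hX, Fintype.card_prod, Fintype.card_fin, mul_comm]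
  rw [← hcard, ← Set.ncard_coe_finset]
  refine Set.ncard_le_ncard_of_injOn f (fun e he => by simpa using hfX e he) ?_ (Set.toFinite _)
  intro e he e' he' hee
  have h1 := hf e he
  rw [hee] at h1
  exact h1.unique A (hf e' he')

end GenericArcs

/-! ### Perturbation into general position -/

section Perturbation

open Filter Topology

/-- The last multiple of `π` below `p` lies at a positive distance, so one bound on `ε` serves all
`m`. -/
lemma eventually_le_int_mul_pi (p c : ℝ) :
    ∀ᶠ ε in 𝓝[>] (0 : ℝ), ∀ m : ℤ, p - ε * c ≤ m * Real.pi → p ≤ m * Real.pi := by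
  have h1 : ((⌈p / Real.pi⌉ : ℝ) - 1) * Real.pi < p := by
    rw [← lt_div_iff₀ Real.pi_pos]
    linarith [Int.ceil_lt_add_one (p / Real.pi)]
  have h2 : p ≤ ⌈p / Real.pi⌉ * Real.pi := by
    rw [← div_le_iff₀ Real.pi_pos]
    exact Int.le_ceil _
  have h3 : ∀ᶠ ε in 𝓝 (0 : ℝ), ((⌈p / Real.pi⌉ : ℝ) - 1) * Real.pi < p - ε * c := by
    refine ContinuousAt.eventually_lt (by fun_prop) (by fun_prop) ?_
    simpa using h1
  filter_upwards [h3.filter_mono nhdsWithin_le_nhds] with ε hε m hm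
  have h4 : (⌈p / Real.pi⌉ : ℝ) - 1 < m := lt_of_mul_lt_mul_right (hε.trans_le hm) Real.pi_pos.le
  have h5 : ⌈p / Real.pi⌉ ≤ m := by
    have : ⌈p / Real.pi⌉ - 1 < m := by exact_mod_cast h4
    omega
  have h6 : (⌈p / Real.pi⌉ : ℝ) ≤ m := by exact_mod_cast h5
  exact h2.trans (mul_le_mul_of_nonneg_right h6 Real.pi_pos.le)

lemma eventually_ne_int_mul_pi (p : ℝ) {q : ℝ} (hq : q ≠ 0) :
    ∀ᶠ ε in 𝓝[>] (0 : ℝ), ∀ m : ℤ, p + ε * q ≠ m * Real.pi := by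
  rcases hq.lt_or_gt with hq | hq
  · filter_upwards [eventually_le_int_mul_pi p (-q), self_mem_nhdsWithin]
      with ε h (hε : 0 < ε) m hm
    have := h m (by linarith)
    nlinarith
  · filter_upwards [eventually_le_int_mul_pi (-p) q, self_mem_nhdsWithin]
      with ε h (hε : 0 < ε) m hm
    have := h (-m) (by push_cast; linarith)
    push_cast at this
    nlinarith

lemma eventually_add_mul_ne {p q : ℝ} (hq : q ≠ 0) : ∀ᶠ ε in 𝓝[>] (0 : ℝ), p + ε * q ≠ 0 := by
  filter_upwards [eventually_ne_int_mul_pi p hq] with ε h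
  simpa using h 0

lemma eventually_notMem_uIcc {f g h : ℝ → ℝ} (hf : Continuous f) (hg : Continuous g)
    (hh : Continuous h) (h0 : f 0 ∉ Set.uIcc (g 0) (h 0)) :
    ∀ᶠ ε in 𝓝[>] (0 : ℝ), f ε ∉ Set.uIcc (g ε) (h ε) := by
  refine Eventually.filter_mono nhdsWithin_le_nhds ?_
  simp only [Set.uIcc, Set.mem_Icc, not_and_or, not_le] at h0 ⊢
  rcases h0 with h0 | h0
  · exact (ContinuousAt.eventually_lt hf.continuousAt (hg.min hh).continuousAt h0).mono
      fun _ h => Or.inl h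
  · exact (ContinuousAt.eventually_lt (hg.max hh).continuousAt hf.continuousAt h0).mono
      fun _ h => Or.inr h

lemma strandPos_eq_of_parity {V : Type*} (v : V) (m : ℤ) :
    ∃ i : Fin 2, ∀ r : V → ℝ, strandPos r (v, m) = strandPos r (v, (i : ℕ)) := by
  rcases Int.even_or_odd m with h | h
  · exact ⟨0, fun r => by simp [strandPos, h.neg_one_zpow]⟩
  · exact ⟨1, fun r => by simp [strandPos, h.neg_one_zpow]⟩

/-- A line of sight survives a small enlargement of all the arcs. -/
lemma StrandSight.eventually {V : Type*} [Finite V] {r a b c : V → ℝ} (hc : ∀ v, 0 < c v)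
    {s s' : V × ℤ} {t : ℝ} (h : StrandSight r a b s s' t) :
    ∀ᶠ ε in 𝓝[>] (0 : ℝ), StrandSight (fun v => r v + ε * c v) (fun v => a v - ε * c v)
      (fun v => b v + ε * c v) s s' t := by
  obtain ⟨⟨h1, h2⟩, ⟨h3, h4⟩, hno⟩ := h
  -- For small `ε` no strand newly reaches the line.
  have hleft := eventually_all.2 fun w : V => eventually_le_int_mul_pi (a w - t) (c w)
  have hright := eventually_all.2 fun w : V => eventually_le_int_mul_pi (t - b w) (c w)
  -- A coordinate depends only on the parity of the index, so finitely many conditions suffice.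
  have hpos : ∀ᶠ ε in 𝓝[>] (0 : ℝ), ∀ (w : V) (i : Fin 2),
      strandPos r (w, (i : ℕ)) ∉ Set.uIcc (strandPos r s) (strandPos r s') →
      strandPos (fun v => r v + ε * c v) (w, (i : ℕ)) ∉
        Set.uIcc (strandPos (fun v => r v + ε * c v) s)
          (strandPos (fun v => r v + ε * c v) s') := by
    refine eventually_all.2 fun w => eventually_all.2 fun i => ?_
    by_cases hmem : strandPos r (w, (i : ℕ)) ∈ Set.uIcc (strandPos r s) (strandPos r s')
    · exact Eventually.of_forall fun _ h => absurd hmem h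
    · refine (eventually_notMem_uIcc
        (f := fun ε => strandPos (fun v => r v + ε * c v) (w, (i : ℕ)))
        (g := fun ε => strandPos (fun v => r v + ε * c v) s)
        (h := fun ε => strandPos (fun v => r v + ε * c v) s') ?_ ?_ ?_ ?_).mono fun _ h _ => h
      · unfold strandPos; fun_prop
      · unfold strandPos; fun_prop
      · unfold strandPos; fun_prop
      · simpa using hmem
  filter_upwards [hleft, hright, hpos, self_mem_nhdsWithin] with ε hl hr hp (hε : 0 < ε)
  have hs := mul_pos hε (hc s.1)
  have hs' := mul_pos hε (hc s'.1)
  refine ⟨⟨by linarith, by linarith⟩, ⟨by linarith, by linarith⟩, ?_⟩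
  rintro ⟨w, m⟩ ⟨hw1, hw2⟩ hws hws'
  simp only at hw1 hw2 hws hws'
  obtain ⟨i, hi⟩ := strandPos_eq_of_parity w m
  rw [hi]
  refine hp w i ?_
  rw [← hi]
  refine hno (w, m) ⟨?_, ?_⟩ hws hws'
  · have := hl w m (by linarith)
    simp only; linarith
  · have := hr w (-m) (by push_cast; linarith)
    push_cast at this
    simp only; linarith

/-- Every family of arcs has a small enlargement in general position. -/
lemma exists_genericArcs {n : ℕ} {ι : Type*} [Finite ι] {r a b : Fin n → ℝ} (hr : ∀ v, 0 < r v)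
    (hab : ∀ v, a v < b v) (hba : ∀ v, b v < a v + 2 * Real.pi)
    (s s' : ι → Fin n × ℤ) (t : ι → ℝ) (h : ∀ i, StrandSight r a b (s i) (s' i) (t i)) :
    ∃ A : GenericArcs (Fin n), ∀ i, StrandSight A.r A.a A.b (s i) (s' i) (t i) := by
  -- With distinct positive increments, each coincidence to be avoided is an affine condition on `ε`
  -- of nonzero slope.
  set c : Fin n → ℝ := fun v => (v : ℝ) + 1 with hc
  have hc0 : ∀ v, 0 < c v := fun v => by positivity
  have hcne : ∀ v w, v ≠ w → c v - c w ≠ 0 := by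
    intro v w hvw h
    refine hvw (Fin.ext ?_)
    have : (v : ℝ) = w := by simp only [hc] at h; linarith
    exact_mod_cast this
  have h1 : ∀ᶠ ε in 𝓝[>] (0 : ℝ), ∀ v w, v ≠ w → (r v - r w) + ε * (c v - c w) ≠ 0 :=
    eventually_all.2 fun v => eventually_all.2 fun w =>
      eventually_imp_distrib_left.2 fun hvw => eventually_add_mul_ne (hcne v w hvw)
  have h2 : ∀ᶠ ε in 𝓝[>] (0 : ℝ), ∀ v w, v ≠ w → ∀ m : ℤ,
      (a w - a v) + ε * (c v - c w) ≠ m * Real.pi :=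
    eventually_all.2 fun v => eventually_all.2 fun w =>
      eventually_imp_distrib_left.2 fun hvw => eventually_ne_int_mul_pi _ (hcne v w hvw)
  have h3 : ∀ᶠ ε in 𝓝[>] (0 : ℝ), ∀ v w, v ≠ w → ∀ m : ℤ,
      (b w - b v) + ε * (c w - c v) ≠ m * Real.pi :=
    eventually_all.2 fun v => eventually_all.2 fun w =>
      eventually_imp_distrib_left.2 fun hvw => eventually_ne_int_mul_pi _ (hcne w v hvw.symm)
  have h4 : ∀ᶠ ε in 𝓝[>] (0 : ℝ), ∀ v w, ∀ m : ℤ,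
      (b w - a v) + ε * (c w + c v) ≠ m * Real.pi :=
    eventually_all.2 fun v => eventually_all.2 fun w =>
      eventually_ne_int_mul_pi _ (add_pos (hc0 w) (hc0 v)).ne'
  have h5 : ∀ᶠ ε in 𝓝[>] (0 : ℝ), ∀ v, b v + ε * c v < a v - ε * c v + 2 * Real.pi := by
    refine eventually_all.2 fun v => Eventually.filter_mono nhdsWithin_le_nhds ?_
    refine ContinuousAt.eventually_lt (by fun_prop) (by fun_prop) ?_
    simpa using hba v
  have h6 := eventually_all.2 fun i => (h i).eventually hc0
  obtain ⟨ε, g1, g2, g3, g4, g5, g6, hε⟩ :=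
    (h1.and (h2.and (h3.and (h4.and (h5.and (h6.and self_mem_nhdsWithin)))))).exists
  replace hε : 0 < ε := hε
  have hεc : ∀ v, 0 < ε * c v := fun v => mul_pos hε (hc0 v)
  refine ⟨⟨fun v => r v + ε * c v, fun v => a v - ε * c v, fun v => b v + ε * c v,
    fun v => add_pos (hr v) (hεc v), ?_, ?_, g5, ?_, ?_, ?_⟩, g6⟩
  · intro v w hvw
    by_contra hne
    exact g1 v w hne (by simp only at hvw; linarith)
  · intro v
    have := hab v
    have := hεc v
    linarith
  · intro v w m hm
    by_contra hne
    exact g2 v w hne m (by linarith)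
  · intro v w m hm
    by_contra hne
    exact g3 v w hne m (by linarith)
  · intro v w m hm
    exact g4 v w m (by linarith)

/-- An arc visibility graph on `n ≥ 1` vertices has at most `3n - 3` edges. -/
theorem ArcRepresentation.ncard_edgeSet_le {n : ℕ} (hn : 0 < n) (R : ArcRepresentation (Fin n)) :
    (R.visibilityGraph 0).edgeSet.ncard ≤ 3 * n - 3 := by
  have : Nonempty (Fin n) := ⟨⟨0, hn⟩⟩
  have hadj : ∀ e : {e : Fin n × Fin n // (R.visibilityGraph 0).Adj e.1 e.2},
      ∃ (t : ℝ) (k l : ℤ), StrandSight (fun w => (R.arc w).radius) (fun w => (R.arc w).α)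
        (fun w => (R.arc w).β) (e.1.1, k) (e.1.2, l) t :=
    fun e => ((R.visibilityGraph_adj_iff _ _).1 e.2).2
  -- One sight for each ordered adjacent pair: finitely many to preserve. New sights do no harm to
  -- the bound.
  choose t k l h using hadj
  obtain ⟨A, hA⟩ := exists_genericArcs (fun v => (R.arc v).radius_pos)
    (fun v => (R.arc v).α_lt_β) (fun v => (R.arc v).β_lt) _ _ _ h
  have := A.card_edges_le (R.visibilityGraph 0) fun u v huv =>
    ⟨_, _, _, hA ⟨(u, v), huv⟩⟩
  rwa [Fintype.card_fin] at this

end Perturbation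

/-! ### The extremal family -/

/-- The negative endpoints, in units of `π / 5`, of a sequence of arcs. -/
noncomputable def nestedLo : ℕ → ℝ
  | 0 => 3
  | 1 => 4
  | 2 => 0
  | 3 => -1
  | 4 => 0
  | j + 5 => 1 / (j + 1)

/-- The positive endpoints, in units of `π / 5`, of a sequence of arcs. -/
noncomputable def nestedHi : ℕ → ℝ
  | 0 => 4
  | 1 => 7
  | 2 => 3
  | 3 => 2
  | 4 => 4
  | j + 5 => 10 - 1 / (j + 1)

lemma nested_bounds (j : ℕ) : nestedLo j < nestedHi j ∧ nestedHi j < nestedLo j + 10 := by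
  match j with
  | 0 => norm_num [nestedLo, nestedHi]
  | 1 => norm_num [nestedLo, nestedHi]
  | 2 => norm_num [nestedLo, nestedHi]
  | 3 => norm_num [nestedLo, nestedHi]
  | 4 => norm_num [nestedLo, nestedHi]
  | j + 5 =>
    have h1 : (0 : ℝ) < 1 / (j + 1) := by positivity
    have h2 : (1 : ℝ) / (j + 1) ≤ 1 := by
      rw [div_le_one (by positivity)]
      linarith [(Nat.cast_nonneg j : (0 : ℝ) ≤ j)]
    simp only [nestedLo, nestedHi]
    constructor <;> linarith

/-- The arcs with radii `1, 2, 3, …` and endpoints `nestedLo` and `nestedHi`. -/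
noncomputable def nestedArc (j : ℕ) : CircularArc where
  radius := j + 1
  α := nestedLo j * (Real.pi / 5)
  β := nestedHi j * (Real.pi / 5)
  radius_pos := by positivity
  α_lt_β := mul_lt_mul_of_pos_right (nested_bounds j).1 (by positivity)
  β_lt := by
    have h := mul_lt_mul_of_pos_right (nested_bounds j).2 (by positivity : 0 < Real.pi / 5)
    linarith

/-- The representation by the first `n` arcs of the sequence. -/
noncomputable def nestedRepresentation (n : ℕ) : ArcRepresentation (Fin n) where
  arc v := nestedArc v
  disjoint u v huv := by
    rw [Set.disjoint_left]
    rintro _ ⟨s, -, rfl⟩ ⟨t, -, h⟩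
    have h1 := congrArg (‖·‖) h
    simp only [norm_circleMap_zero, abs_of_pos (nestedArc _).radius_pos] at h1
    simp only [nestedArc, add_left_inj, Nat.cast_inj] at h1
    exact huv (Fin.ext h1.symm)

/-- In units of `π / 5` a half turn is `5`. Obstacles are excluded among all arcs of the sequence,
so the sight is valid for every `n`. -/
lemma nested_adj {n : ℕ} {i j : Fin n} (hij : i ≠ j) (τ : ℝ) (k l : ℤ)
    (hi : nestedLo i ≤ τ + 5 * k ∧ τ + 5 * k ≤ nestedHi i)
    (hj : nestedLo j ≤ τ + 5 * l ∧ τ + 5 * l ≤ nestedHi j)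
    (h : ∀ (w : ℕ) (m : ℤ), nestedLo w ≤ τ + 5 * m → τ + 5 * m ≤ nestedHi w →
      w ≠ i → w ≠ j → (-1 : ℝ) ^ m * (w + 1) ∉
        Set.uIcc ((-1 : ℝ) ^ k * ((i : ℕ) + 1)) ((-1 : ℝ) ^ l * ((j : ℕ) + 1))) :
    ((nestedRepresentation n).visibilityGraph 0).Adj i j := by
  have hpres : ∀ (w : Fin n) (m : ℤ), StrandPresent
      (fun w => ((nestedRepresentation n).arc w).α) (fun w => ((nestedRepresentation n).arc w).β)
      (w, m) (τ * (Real.pi / 5)) ↔ nestedLo w ≤ τ + 5 * m ∧ τ + 5 * m ≤ nestedHi w := by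
    intro w m
    have hπ : 0 < Real.pi / 5 := by positivity
    have e : (m : ℝ) * Real.pi = (5 * m) * (Real.pi / 5) := by ring
    simp only [StrandPresent, nestedRepresentation, nestedArc]
    rw [e, ← sub_mul, ← sub_mul, mul_le_mul_iff_left₀ hπ, mul_le_mul_iff_left₀ hπ, sub_le_iff_le_add,
      le_sub_iff_add_le]
  refine (ArcRepresentation.visibilityGraph_adj_iff _ _ _).2 ⟨hij, τ * (Real.pi / 5), k, l,
    (hpres _ _).2 hi, (hpres _ _).2 hj, ?_⟩
  rintro ⟨w, m⟩ hw hwi hwj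
  have := (hpres w m).1 hw
  exact h w m this.1 this.2 (fun h => hwi (Fin.ext h)) (fun h => hwj (Fin.ext h))

/-! ### The six innermost arcs -/

/-- The integral endpoints of the first six arcs. -/
def sixLo : Fin 6 → ℤ := ![3, 4, 0, -1, 0, 1]

/-- The integral endpoints of the first six arcs. -/
def sixHi : Fin 6 → ℤ := ![4, 7, 3, 2, 4, 9]

/-- The signed coordinate of a strand of one of the first six arcs. -/
def sixPos (w : Fin 6) (m : ℤ) : ℤ := if m = 0 then w + 1 else -(w + 1)

-- Directions that are multiples of `π / 10` suffice, so doubling makes everything integral: `T`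
-- covers a half turn, and the indices are shifted to `-1`, `0`, `1`.
set_option synthInstance.maxSize 1024 in
lemma six_sight : ∀ i j : Fin 6, i < j → ∃ (T : Fin 10) (k l : Fin 3),
    (2 * sixLo i ≤ T + 10 * (k - 1 : ℤ) ∧ T + 10 * (k - 1 : ℤ) ≤ 2 * sixHi i) ∧
    (2 * sixLo j ≤ T + 10 * (l - 1 : ℤ) ∧ T + 10 * (l - 1 : ℤ) ≤ 2 * sixHi j) ∧
    ∀ (w : Fin 6) (m : Fin 3), 2 * sixLo w ≤ T + 10 * (m - 1 : ℤ) →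
      T + 10 * (m - 1 : ℤ) ≤ 2 * sixHi w → w ≠ i → w ≠ j →
      ¬ (sixPos i (k - 1) ≤ sixPos w (m - 1) ∧ sixPos w (m - 1) ≤ sixPos j (l - 1)) ∧
      ¬ (sixPos j (l - 1) ≤ sixPos w (m - 1) ∧ sixPos w (m - 1) ≤ sixPos i (k - 1)) := by
  decide +kernel

lemma sixLo_eq (i : Fin 6) : nestedLo i = sixLo i := by
  fin_cases i <;> simp [nestedLo, sixLo]

lemma sixHi_eq (i : Fin 6) : nestedHi i = sixHi i := by
  fin_cases i <;> simp [nestedHi, sixHi]; norm_num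

lemma sixPos_eq (w : Fin 6) (m : Fin 3) :
    (-1 : ℝ) ^ ((m : ℤ) - 1) * ((w : ℕ) + 1) = sixPos w (m - 1) := by
  fin_cases m <;> simp [sixPos]

lemma sixPos_bounds (w : Fin 6) (m : ℤ) : -6 ≤ sixPos w m ∧ sixPos w m ≤ 6 := by
  have := w.2
  unfold sixPos
  split_ifs <;> constructor <;> omega

lemma nested_adj_six {n : ℕ} {i j : Fin n} (hij : i < j) (hj : (j : ℕ) < 6) :
    ((nestedRepresentation n).visibilityGraph 0).Adj i j := by
  have hi6 : (i : ℕ) < 6 := lt_trans hij hj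
  obtain ⟨T, k, l, h1, h2, h3⟩ := six_sight ⟨i, hi6⟩ ⟨j, hj⟩ hij
  have hT : ∀ m : ℤ, ((T : ℕ) : ℝ) / 2 + 5 * m = ((T + 10 * m : ℤ) : ℝ) / 2 := by
    intro m; push_cast; ring
  have hle : ∀ x y : ℤ, (x : ℝ) ≤ (y : ℝ) / 2 ↔ 2 * x ≤ y := by
    intro x y
    rw [le_div_iff₀ two_pos, mul_comm]; norm_cast
  have hge : ∀ x y : ℤ, (y : ℝ) / 2 ≤ (x : ℝ) ↔ y ≤ 2 * x := by
    intro x y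
    rw [div_le_iff₀ two_pos, mul_comm]; norm_cast
  have ei := sixLo_eq ⟨i, hi6⟩
  have ei' := sixHi_eq ⟨i, hi6⟩
  have ej := sixLo_eq ⟨j, hj⟩
  have ej' := sixHi_eq ⟨j, hj⟩
  simp only at ei ei' ej ej'
  refine nested_adj hij.ne ((T : ℕ) / 2) (k - 1) (l - 1) ?_ ?_ ?_
  · rw [hT, ei, ei', hle, hge]; exact h1
  · rw [hT, ej, ej', hle, hge]; exact h2
  · intro w m hw1 hw2 hwi hwj hmem
    have ep := sixPos_eq ⟨i, hi6⟩ k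
    have ep' := sixPos_eq ⟨j, hj⟩ l
    simp only at ep ep'
    rw [ep, ep', Set.mem_uIcc] at hmem
    have b1 := sixPos_bounds ⟨i, hi6⟩ (k - 1)
    have b2 := sixPos_bounds ⟨j, hj⟩ (l - 1)
    by_cases hw6 : w < 6
    · have ew := sixLo_eq ⟨w, hw6⟩
      have ew' := sixHi_eq ⟨w, hw6⟩
      simp only at ew ew'
      rw [hT, ew, hle] at hw1
      rw [hT, ew', hge] at hw2
      have hlo : ∀ w, -1 ≤ sixLo w := by decide
      have hhi : ∀ w, sixHi w ≤ 9 := by decide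
      have h4 := hlo ⟨w, hw6⟩
      have h5 := hhi ⟨w, hw6⟩
      have hT' := T.2
      -- The endpoints lie in `[-1, 9]` and the direction in `[0, 5)`, which leaves only three
      -- indices.
      obtain ⟨m', rfl⟩ : ∃ m' : Fin 3, m = m' - 1 :=
        ⟨⟨(m + 1).toNat, by omega⟩, by simp only; omega⟩
      have epw := sixPos_eq ⟨w, hw6⟩ m'
      simp only at epw
      rw [epw] at hmem
      have := h3 ⟨w, hw6⟩ m' hw1 hw2 (fun h => hwi (congrArg Fin.val h))
        (fun h => hwj (congrArg Fin.val h))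
      rcases hmem with hmem | hmem
      · exact this.1 (by exact_mod_cast hmem)
      · exact this.2 (by exact_mod_cast hmem)
    -- Arcs beyond the sixth have radius at least `7`, outside the segment.
    · have b1' : (-6 : ℝ) ≤ sixPos ⟨i, hi6⟩ (k - 1) ∧
          (sixPos ⟨i, hi6⟩ (k - 1) : ℝ) ≤ 6 := by exact_mod_cast b1
      have b2' : (-6 : ℝ) ≤ sixPos ⟨j, hj⟩ (l - 1) ∧
          (sixPos ⟨j, hj⟩ (l - 1) : ℝ) ≤ 6 := by exact_mod_cast b2
      have hw7 : (6 : ℝ) ≤ w := by exact_mod_cast not_lt.1 hw6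
      rcases Int.even_or_odd m with hm | hm <;> rw [hm.neg_one_zpow] at hmem <;>
        rcases hmem with hmem | hmem <;> linarith [hmem.1, hmem.2, b1'.1, b1'.2, b2'.1, b2'.2]

/-! ### The later arcs -/

lemma even_of_mem_uIcc {i j w : ℕ} {m : ℤ} (hij : i ≤ j)
    (h : (-1 : ℝ) ^ m * (w + 1) ∈ Set.uIcc ((i : ℝ) + 1) (j + 1)) :
    ∃ q : ℤ, m = 2 * q ∧ i ≤ w ∧ w ≤ j := by
  have hij' : (i : ℝ) ≤ j := by exact_mod_cast hij
  rw [Set.uIcc_of_le (by linarith)] at h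
  rcases Int.even_or_odd m with hm | hm
  · rw [hm.neg_one_zpow, one_mul] at h
    obtain ⟨q, hq⟩ := hm
    refine ⟨q, by omega, ?_, ?_⟩
    · have : (i : ℝ) ≤ w := by linarith [h.1]
      exact_mod_cast this
    · have : (w : ℝ) ≤ j := by linarith [h.2]
      exact_mod_cast this
  · rw [hm.neg_one_zpow] at h
    have : (0 : ℝ) ≤ i := by positivity
    have : (0 : ℝ) ≤ w := by positivity
    linarith [h.1]

lemma nested_lo_pos {j : ℕ} (hj : 5 ≤ j) : 0 < nestedLo j ∧ nestedLo j ≤ 1 ∧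
    nestedHi j = 10 - nestedLo j := by
  obtain ⟨j, rfl⟩ := Nat.exists_eq_add_of_le' hj
  simp only [nestedLo, nestedHi]
  refine ⟨by positivity, ?_, trivial⟩
  rw [div_le_one (by positivity)]
  linarith [(Nat.cast_nonneg j : (0 : ℝ) ≤ j)]

lemma nested_lo_lt {i j : ℕ} (hi : 5 ≤ i) (hij : i < j) : nestedLo j < nestedLo i := by
  obtain ⟨i, rfl⟩ := Nat.exists_eq_add_of_le' hi
  obtain ⟨j, rfl⟩ := Nat.exists_eq_add_of_le' (hi.trans hij.le)
  simp only [nestedLo]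
  refine one_div_lt_one_div_of_lt (by positivity) ?_
  have : (i : ℝ) < j := by exact_mod_cast (by omega : i < j)
  linarith

/-- Where the arc `j` begins, the arcs from `5` to `j - 1` are in their wider gaps. -/
lemma nested_adj_four {n : ℕ} {i j : Fin n} (hi : (i : ℕ) = 4) (hj : 6 ≤ (j : ℕ)) :
    ((nestedRepresentation n).visibilityGraph 0).Adj i j := by
  obtain ⟨d0, d1, d2⟩ := nested_lo_pos (j := j) (by omega)
  refine nested_adj (by rintro rfl; omega) (nestedLo j) 0 0 ?_ ?_ ?_
  · have e : nestedLo 4 = 0 ∧ nestedHi 4 = 4 := ⟨rfl, rfl⟩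
    rw [hi, e.1, e.2, Int.cast_zero]; constructor <;> linarith
  · rw [d2]; simp only [Int.cast_zero]; constructor <;> linarith
  · intro w m h1 h2 hwi hwj hmem
    simp only [zpow_zero, one_mul] at hmem
    obtain ⟨q, rfl, h3, h4⟩ := even_of_mem_uIcc (by omega) hmem
    obtain ⟨e0, e1, e2⟩ := nested_lo_pos (j := w) (by omega)
    have hlt := nested_lo_lt (i := w) (j := j) (by omega) (by omega)
    rw [e2] at h2
    push_cast at h1 h2
    have hq : (0 : ℝ) < q := by linarith
    have hq' : (1 : ℝ) ≤ q := by
      have : 0 < q := by exact_mod_cast hq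
      exact_mod_cast (by omega : 1 ≤ q)
    linarith

/-- Now the end of the arc `j` is used, at `-nestedLo j` plus a full turn (hence index `2`): the arc
`4` has not begun there, while the arc `3` has. -/
lemma nested_adj_three {n : ℕ} {i j : Fin n} (hi : (i : ℕ) = 3) (hj : 6 ≤ (j : ℕ)) :
    ((nestedRepresentation n).visibilityGraph 0).Adj i j := by
  obtain ⟨d0, d1, d2⟩ := nested_lo_pos (j := j) (by omega)
  refine nested_adj (by rintro rfl; omega) (-nestedLo j) 0 2 ?_ ?_ ?_
  · have e : nestedLo 3 = -1 ∧ nestedHi 3 = 2 := ⟨rfl, rfl⟩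
    rw [hi, e.1, e.2, Int.cast_zero]; constructor <;> linarith
  · rw [d2]; push_cast; constructor <;> linarith
  · intro w m h1 h2 hwi hwj hmem
    have e : (-1 : ℝ) ^ (2 : ℤ) = 1 := by norm_num
    simp only [zpow_zero, one_mul, e] at hmem
    obtain ⟨q, rfl, h3, h4⟩ := even_of_mem_uIcc (by omega) hmem
    push_cast at h1 h2
    have hlo : 0 ≤ nestedLo w := by
      rcases (by omega : w = 4 ∨ 5 ≤ w) with rfl | hw
      · simp [nestedLo]
      · exact (nested_lo_pos hw).1.le
    have hq : (0 : ℝ) < q := by linarith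
    have hq' : (1 : ℝ) ≤ q := by
      have : 0 < q := by exact_mod_cast hq
      exact_mod_cast (by omega : 1 ≤ q)
    rcases (by omega : w = 4 ∨ 5 ≤ w) with rfl | hw
    · simp only [nestedHi] at h2; linarith
    · have hlt := nested_lo_lt (i := w) (j := j) hw (by omega)
      rw [(nested_lo_pos hw).2.2] at h2
      linarith

/-- The argument `5`, opposite the gaps, belongs to both arcs, and no radius lies between theirs. -/
lemma nested_adj_succ {n : ℕ} {i j : Fin n} (hi : 5 ≤ (i : ℕ)) (hj : (i : ℕ) + 1 = j) :
    ((nestedRepresentation n).visibilityGraph 0).Adj i j := by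
  obtain ⟨d0, d1, d2⟩ := nested_lo_pos hi
  obtain ⟨e0, e1, e2⟩ := nested_lo_pos (j := j) (by omega)
  refine nested_adj (by rintro rfl; omega) 5 0 0 ?_ ?_ ?_
  · rw [d2]; simp only [Int.cast_zero]; constructor <;> linarith
  · rw [e2]; simp only [Int.cast_zero]; constructor <;> linarith
  · intro w m h1 h2 hwi hwj hmem
    simp only [zpow_zero, one_mul] at hmem
    obtain ⟨q, rfl, h3, h4⟩ := even_of_mem_uIcc (by omega) hmem
    omega

/-- Earlier arcs of the sequence that the arc `j` sees. -/
def nestedNbrs (j : ℕ) : Finset ℕ := if j < 6 then Finset.range j else {3, 4, j - 1}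

lemma sum_card_nestedNbrs {n : ℕ} (hn : 6 ≤ n) :
    ∑ j ∈ Finset.range n, (nestedNbrs j).card = 3 * n - 3 := by
  induction n, hn using Nat.le_induction with
  | base => decide
  | succ n hn ih =>
    have : (nestedNbrs n).card = 3 := by
      rw [nestedNbrs, if_neg (by omega), Finset.card_eq_three]
      exact ⟨3, 4, n - 1, by omega, by omega, by omega, rfl⟩
    rw [Finset.sum_range_succ, ih, this]
    omega

lemma nested_ncard_ge {n : ℕ} (hn : 6 ≤ n) :
    3 * n - 3 ≤ ((nestedRepresentation n).visibilityGraph 0).edgeSet.ncard := by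
  have hlt : ∀ {j i : ℕ}, i ∈ nestedNbrs j → i < j := by
    intro j i hi
    unfold nestedNbrs at hi
    split_ifs at hi with h
    · exact Finset.mem_range.1 hi
    · simp only [Finset.mem_insert, Finset.mem_singleton] at hi
      omega
  rw [← sum_card_nestedNbrs hn, ← Finset.card_sigma, ← Set.ncard_coe_finset,
    ← Set.ncard_image_of_injective _ (Sym2.map.injective (Fin.val_injective (n := n)))]
  refine Set.ncard_le_ncard_of_injOn (fun p => s(p.2, p.1)) ?_ ?_ (Set.toFinite _)
  · rintro ⟨j, i⟩ hp
    simp only [Finset.mem_coe, Finset.mem_sigma, Finset.mem_range] at hp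
    have hij := hlt hp.2
    refine ⟨s(⟨i, hij.trans hp.1⟩, ⟨j, hp.1⟩), ?_, rfl⟩
    rw [SimpleGraph.mem_edgeSet]
    have h2 := hp.2
    unfold nestedNbrs at h2
    split_ifs at h2 with h
    · exact nested_adj_six hij h
    · simp only [Finset.mem_insert, Finset.mem_singleton] at h2
      rcases h2 with rfl | rfl | rfl
      · exact nested_adj_three rfl (not_lt.1 h)
      · exact nested_adj_four rfl (not_lt.1 h)
      · exact nested_adj_succ (by simp only; omega) (by simp only; omega)
  · rintro ⟨j, i⟩ hp ⟨j', i'⟩ hp' he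
    simp only [Finset.mem_coe, Finset.mem_sigma, Finset.mem_range] at hp hp'
    have h1 := hlt hp.2
    have h2 := hlt hp'.2
    rcases Sym2.eq_iff.1 he with ⟨h3, h4⟩ | ⟨h3, h4⟩
    · simp only at h3 h4
      subst h3 h4
      rfl
    · simp only at h3 h4
      omega

lemma nested_eq_top {n : ℕ} (hn : n ≤ 6) : (nestedRepresentation n).visibilityGraph 0 = ⊤ := by
  ext i j
  rw [SimpleGraph.top_adj]
  refine ⟨fun h => h.ne, fun h => ?_⟩
  rcases h.lt_or_gt with h | h
  · exact nested_adj_six h (by omega)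
  · exact (nested_adj_six h (by omega)).symm

theorem mainTheorem10 (n : ℕ) :
    (n ≤ 5 → IsGreatest (arcVisibilityEdgeCounts n) (n.choose 2)) ∧
      (6 ≤ n → IsGreatest (arcVisibilityEdgeCounts n) (3 * n - 3)) := by
  classical
  constructor
  · intro hn
    refine ⟨⟨_, ⟨nestedRepresentation n, rfl⟩, ?_⟩, ?_⟩
    · rw [nested_eq_top (by omega), ← SimpleGraph.coe_edgeFinset, Set.ncard_coe_finset,
        SimpleGraph.card_edgeFinset_top_eq_card_choose_two, Fintype.card_fin]
    · rintro m ⟨G, -, rfl⟩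
      rw [← SimpleGraph.coe_edgeFinset, Set.ncard_coe_finset]
      exact G.card_edgeFinset_le_card_choose_two.trans_eq (by rw [Fintype.card_fin])
  · intro hn
    refine ⟨⟨_, ⟨nestedRepresentation n, rfl⟩, ?_⟩, ?_⟩
    · exact le_antisymm (ArcRepresentation.ncard_edgeSet_le (by omega) _) (nested_ncard_ge hn)
    · rintro m ⟨G, ⟨R, rfl⟩, rfl⟩
      exact ArcRepresentation.ncard_edgeSet_le (by omega) R
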